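/- **Conventions.** $L$ is a first-order language, $T$ a (possibly incomplete) $L$-theory; models and substructures are non-empty. $T$ is *Skolemized* if every substructure of every model of $T$ is an elementary substructure. An $L$-formula $\varphi(\bar x_1,\bar x_2)$, with $\bar x_1,\bar x_2$ tuples of variables of the same finite length $k$, *codes graphs* (with respect to $T$) if for every symmetric irreflexive graph $(V,R)$ there are a model $M$ of $T$ and $k$-tuples $\bar c_g$ $(g\in V)$ from $M$ such that for all $g,h\in V$: $M\models\varphi(\bar c_g,\bar c_h)$ if and only if $R(g,h)$. An *ordered graph* is a structure $(G,\le,R)$ with $\le$ a linear order on $G$ and $R$ a symmetric irreflexive binary relation on $G$; subgraphs carry the induced order and the induced edge relation. The *definable closure* of a subset $A$ of a structure $M$ is the set of all $b\in M$ such that $\{b\}$ is definable in $M$ with parameters from $A$. **Theorem.** Let $T$ be a Skolemized $L$-theory and let $\varphi(\bar x_1,\bar x_2)$ be an $L$-formula that codes graphs with respect to $T$. For every ordered graph $(G,\le,R)$ (non-empty, or arbitrary if $L$ has a constant symbol) there are a model $M_G$ of $T$ and $k$-tuples $\bar a_g$ $(g\in G)$ from $M_G$ (the *skeleton*) such that: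 1. the universe of $M_G$ is the definable closure of the set of all entries of the tuples $\bar a_g$, $g\in G$; 2. if $f:H_1\to H_2$ is an isomorphism of ordered graphs between finite subgraphs of $G$, then $$M_G\models\psi(\bar a_g:g\in H_1)\leftrightarrow\psi(\bar a_{f(g)}:g\in H_1)$$ for every $L$-formula $\psi$; 3. for all $g,h\in G$, $M_G\models\varphi(\bar a_g,\bar a_h)$ if and only if $R(g,h)$. -/

import Mathlib

universe u v w

namespace GraphEM

open FirstOrder.Language

variable {L : FirstOrder.Language.{u, v}}

/-- A theory is Skolemized if every substructure of every model of it is an elementary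
substructure. Models and substructures are non-empty, as is the usual convention. -/
def IsSkolemized (T : L.Theory) : Prop :=
  ∀ (M : Theory.ModelType.{u, v, w} T) (S : L.Substructure M), (S : Set M).Nonempty → S.IsElementary

/-- The formula `φ(x̄₁, x̄₂)`, in two tuples of variables of the same length `k`, codes graphs
with respect to `T`: for every (symmetric, irreflexive) graph there are a model of `T` and
`k`-tuples of its elements, indexed by the vertices, on which `φ` defines the edge relation. -/
def CodesGraphs (T : L.Theory) {k : ℕ} (φ : L.Formula (Fin k ⊕ Fin k)) : Prop :=
  ∀ (V : Type w) (R : SimpleGraph V),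
    ∃ (M : Theory.ModelType.{u, v, max u v w} T) (c : V → Fin k → M),
      ∀ g h : V, φ.Realize (Sum.elim (c g) (c h)) ↔ R.Adj g h

/-- The definable closure of a set `A`: all elements `b` such that `{b}` is definable with
parameters from `A`. -/
def dcl (L : FirstOrder.Language.{u, v}) {M : Type w} [L.Structure M] (A : Set M) : Set M :=
  {b | A.Definable₁ L {b}}

/-- Tuples indexed by an ordered graph are indiscernible: any isomorphism between finite
(induced) ordered subgraphs preserves the truth of all formulas about the corresponding tuples.
The variables of `ψ` are indexed by a vertex `g ∈ H₁` and a position in the tuple `a g`. -/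
def GraphIndiscernible (L : FirstOrder.Language.{u, v}) {G : Type*} [LinearOrder G] (R : SimpleGraph G)
    {M : Type*} [L.Structure M] {k : ℕ} (a : G → Fin k → M) : Prop :=
  ∀ (H₁ H₂ : Finset G) (f : H₁ ≃o H₂),
    (∀ g h : H₁, R.Adj (f g) (f h) ↔ R.Adj g h) →
    ∀ ψ : L.Formula (H₁ × Fin k),
      ψ.Realize (fun p => a p.1 p.2) ↔ ψ.Realize (fun p => a (f p.1) p.2)

end GraphEM

/-! By compactness, finitely many vertices and formulas suffice: `exists_graphIndiscernible` glues
the finite cases in an ultraproduct, and Skolemization makes the substructure generated by the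
skeleton elementary; its elements are values of terms, hence definable. The finite case is Ramsey
theory. A Ramsey graph for the given finite ordered graph is coded in a model of `T`, tuples of
vertices are coloured by the truth of the formulas, and a homogeneous copy is the skeleton. To build
the Ramsey graph, `exists_partite_ramsey` (Hales–Jewett) makes the colour of a copy depend only on
the levels it occupies, and Ramsey's theorem on the linear order of levels removes that dependence.
-/

namespace GraphEM

variable {L : FirstOrder.Language.{u, v}}

/-! ### Ramsey's theorem for finite sets, by iterated ultrafilter limits -/

open Filter in
/-- The finite Ramsey theorem for finite sets, for finitely many colourings at once and uniformly
along an ultrafilter: a sequence of families of colourings of the finite subsets of `ℕ` has, for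
every `b`, a `b`-element set that is homogeneous in all sizes below `m` for frequently many of
them. -/
theorem exists_homogeneous_finset {J : Type*} [Finite J] (χ : ℕ → J → Finset ℕ → Prop) (m b : ℕ) :
    ∃ (n : ℕ) (F : Finset ℕ), F.card = b ∧ (∀ x ∈ F, x < n) ∧
      ∀ j, ∀ s ⊆ F, ∀ t ⊆ F, s.card = t.card → s.card < m → (χ n j s ↔ χ n j t) := by
  classical
  let U : Ultrafilter ℕ := hyperfilter ℕ
  have hU : ∀ n : ℕ, ∀ᶠ y in (U : Filter ℕ), n < y := fun n =>
    Nat.hyperfilter_le_atTop (eventually_gt_atTop n)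
  have lim_iff : ∀ p : ℕ → Prop, ∀ᶠ y in (U : Filter ℕ), (p y ↔ ∀ᶠ z in (U : Filter ℕ), p z) := by
    intro p
    by_cases hp : ∀ᶠ z in (U : Filter ℕ), p z
    · filter_upwards [hp] with y hy using iff_of_true hy hp
    · filter_upwards [Ultrafilter.eventually_not.2 hp] with y hy using iff_of_false hy hp
  -- `lim d j s` is the limit colour of `s` enlarged by `d` generic points.
  let lim : ℕ → J → Finset ℕ → Prop := fun d => Nat.rec
    (fun j s => ∀ᶠ n in (U : Filter ℕ), χ n j s)
    (fun _ c j s => ∀ᶠ y in (U : Filter ℕ), c j (insert y s)) d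
  -- The points of `F` behave generically, so the limit colour of a subset depends only on its size.
  have key : ∀ b : ℕ, ∃ F : Finset ℕ, F.card = b ∧
      ∀ j, ∀ s ⊆ F, ∀ d, d + s.card < m → (lim d j s ↔ lim (d + s.card) j ∅) := by
    intro b
    induction b with
    | zero =>
      refine ⟨∅, rfl, fun j s hs d _ => ?_⟩
      rw [Finset.subset_empty.1 hs]; rfl
    | succ b ih =>
      obtain ⟨F, hF, h⟩ := ih
      have h1 : ∀ᶠ y in (U : Filter ℕ), ∀ j, ∀ s ∈ F.powerset, ∀ d ∈ Finset.range m,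
          (lim d j (insert y s) ↔ lim (d + 1) j s) := by
        rw [eventually_all]; intro j
        rw [Finset.eventually_all]; intro s _
        rw [Finset.eventually_all]; intro d _
        exact lim_iff _
      have h2 : ∀ᶠ y in (U : Filter ℕ), ∀ x ∈ F, x < y := by
        rw [Finset.eventually_all]; exact fun x _ => hU x
      obtain ⟨y, hy, hyF⟩ := (h1.and h2).exists
      have hy' : y ∉ F := fun h => lt_irrefl _ (hyF y h)
      refine ⟨insert y F, by rw [Finset.card_insert_of_notMem hy', hF], fun j s hs d hd => ?_⟩
      by_cases hys : y ∈ s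
      · have hsF : s.erase y ⊆ F := Finset.subset_insert_iff.1 hs
        have hc : (s.erase y).card + 1 = s.card := Finset.card_erase_add_one hys
        have := hy j (s.erase y) (Finset.mem_powerset.2 hsF) d (Finset.mem_range.2 (by omega))
        rw [Finset.insert_erase hys] at this
        rw [this, h j _ hsF (d + 1) (by omega), ← hc, add_assoc, add_comm 1]
      · exact h j s ((Finset.subset_insert_iff_of_notMem hys).1 hs) d hd
  obtain ⟨F, hF, h⟩ := key b
  have h1 : ∀ᶠ n in (U : Filter ℕ), ∀ j, ∀ s ∈ F.powerset, (χ n j s ↔ lim 0 j s) := by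
    rw [eventually_all]; intro j
    rw [Finset.eventually_all]; intro s _
    exact lim_iff _
  have h2 : ∀ᶠ n in (U : Filter ℕ), ∀ x ∈ F, x < n := by
    rw [Finset.eventually_all]; exact fun x _ => hU x
  obtain ⟨n, hn, hnF⟩ := (h1.and h2).exists
  refine ⟨n, F, hF, hnF, fun j s hs t ht hst hm => ?_⟩
  rw [hn j s (Finset.mem_powerset.2 hs), hn j t (Finset.mem_powerset.2 ht),
    h j s hs 0 (by omega), h j t ht 0 (by omega), hst]

/-! ### The partite lemma -/

/-- Maps of graphs that preserve and reflect adjacency and respect the levels of the vertices. -/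
structure IsLevelHom {V W I : Type*} (R : SimpleGraph V) (π : V → I) (R' : SimpleGraph W)
    (π' : W → I) (β : V → W) : Prop where
  adj_iff : ∀ x y, R'.Adj (β x) (β y) ↔ R.Adj x y
  level : ∀ x, π' (β x) = π x

theorem IsLevelHom.comp {V W X I : Type*} {R : SimpleGraph V} {π : V → I} {R' : SimpleGraph W}
    {π' : W → I} {R'' : SimpleGraph X} {π'' : X → I} {β : V → W} {γ : W → X}
    (hγ : IsLevelHom R' π' R'' π'' γ) (hβ : IsLevelHom R π R' π' β) :
    IsLevelHom R π R'' π'' (γ ∘ β) :=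
  ⟨fun x y => (hγ.adj_iff _ _).trans (hβ.adj_iff x y), fun x => (hγ.level _).trans (hβ.level x)⟩

/-- The partite lemma: for a finite levelled graph `R` there is a finite levelled graph such that
for every colouring of tuples there is a copy of `R` in which all copies of `S` on the levels `e`
have the same colour. -/
theorem exists_partite_ramsey {V A : Type w} {I : Type} [Finite V] [Finite A] [Finite I]
    (R : SimpleGraph V) (π : V → I) (S : SimpleGraph A) (e : A → I) (he : e.Injective) :
    ∃ (W : Type w) (_ : Finite W) (R' : SimpleGraph W) (π' : W → I), ∀ χ : (A → W) → Prop,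
      ∃ β, IsLevelHom R π R' π' β ∧ ∃ c, ∀ α, IsLevelHom S e R π α → χ (β ∘ α) = c := by
  classical
  let Λ := {α : A → V // IsLevelHom S e R π α}
  obtain ⟨ι, _, hι⟩ := Combinatorics.Line.exists_mono_in_high_dimension Λ Prop
  let F : I → I → Prop := fun j k => ∃ s t, e s = j ∧ e t = k ∧ S.Adj s t
  let r : Option V → Option V → Prop := fun x y => ∃ v ∈ x, ∃ w ∈ y, R.Adj v w
  have r_symm : ∀ x y, r x y → r y x := fun x y ⟨v, hv, w, hw, h⟩ => ⟨w, hw, v, hv, h.symm⟩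
  have F_symm : ∀ x y, F x y → F y x := fun x y ⟨s, t, hs, ht, h⟩ => ⟨t, s, ht, hs, h.symm⟩
  -- The quantifier is chosen so that fixed coordinates of a line are neutral: there `r` holds
  -- exactly when `F` does, so adjacency is decided by the moving coordinates, where it is that of
  -- `R`.
  let R' : SimpleGraph (I × (ι → Option V)) :=
    { Adj := fun x y => if F x.1 y.1 then ∀ i, r (x.2 i) (y.2 i) else ∃ i, r (x.2 i) (y.2 i)
      symm := ⟨fun x y h => by
        by_cases hF : F x.1 y.1
        · rw [if_pos hF] at h
          rw [if_pos (F_symm _ _ hF)]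
          exact fun i => r_symm _ _ (h i)
        · rw [if_neg hF] at h
          rw [if_neg (fun h' => hF (F_symm _ _ h'))]
          exact h.imp fun i => r_symm _ _⟩
      loopless := ⟨fun x h => by
        have hF : ¬ F x.1 x.1 := by
          rintro ⟨s, t, hs, ht, h⟩
          exact h.ne (he (hs.trans ht.symm))
        rw [if_neg hF] at h
        obtain ⟨i, v, hv, w, hw, h⟩ := h
        exact h.ne (Option.mem_unique hv hw)⟩ }
  refine ⟨I × (ι → Option V), inferInstance, R', Prod.fst, fun χ => ?_⟩
  obtain ⟨l, c, hc⟩ := hι fun x => χ fun s => (e s, fun i => some ((x i).1 s))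
  obtain ⟨i₀, hi₀⟩ := l.proper
  let fill : Λ → I → Option V := fun μ j => if h : ∃ s, e s = j then some (μ.1 h.choose) else none
  have fill_e : ∀ μ s, fill μ (e s) = some (μ.1 s) := by
    intro μ s
    have h : ∃ s', e s' = e s := ⟨s, rfl⟩
    simp only [fill, dif_pos h, he h.choose_spec]
  have fill_r : ∀ μ j k, r (fill μ j) (fill μ k) ↔ F j k := by
    intro μ j k
    constructor
    · rintro ⟨v, hv, w, hw, h⟩
      by_cases hj : ∃ s, e s = j
      · by_cases hk : ∃ s, e s = k
        · obtain ⟨s, rfl⟩ := hj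
          obtain ⟨t, rfl⟩ := hk
          rw [fill_e, Option.mem_some_iff] at hv hw
          subst hv hw
          exact ⟨s, t, rfl, rfl, (μ.2.adj_iff s t).1 h⟩
        · simp [fill, dif_neg hk] at hw
      · simp [fill, dif_neg hj] at hv
    · rintro ⟨s, t, rfl, rfl, h⟩
      exact ⟨_, fill_e μ s, _, fill_e μ t, (μ.2.adj_iff s t).2 h⟩
  let β : V → I × (ι → Option V) := fun v =>
    (π v, fun i => (l.idxFun i).elim (some v) fun μ => fill μ (π v))
  have β_r : ∀ v w i, r ((β v).2 i) ((β w).2 i) ↔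
      (l.idxFun i = none ∧ R.Adj v w) ∨ (l.idxFun i ≠ none ∧ F (π v) (π w)) := by
    intro v w i
    cases h : l.idxFun i with
    | none => simp [β, h, r]
    | some μ => simp [β, h, fill_r]
  refine ⟨β, ⟨fun v w => ?_, fun _ => rfl⟩, c, fun α hα => ?_⟩
  · change (if F (π v) (π w) then _ else _) ↔ _
    simp only [β_r]
    split_ifs with hF
    · refine ⟨fun h => ?_, fun h i => ?_⟩
      · simpa [hi₀] using h i₀
      · by_cases hi : l.idxFun i = none <;> simp [hi, h, hF]
    · simp only [hF, and_false, or_false]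
      exact ⟨fun ⟨i, h⟩ => h.2, fun h => ⟨i₀, hi₀, h⟩⟩
  -- `β ∘ α` is the tuple coloured at the point of the line with letter `α`.
  · rw [← hc ⟨α, hα⟩]
    congr 1
    funext s
    refine Prod.ext (hα.level s) (funext fun i => ?_)
    change (l.idxFun i).elim (some (α s)) (fun μ => fill μ (π (α s))) = _
    rw [hα.level]
    cases h : l.idxFun i with
    | none => simp [h]
    | some μ => simp [h, fill_e]

/-- The partite lemma for finitely many patterns `(S j, e j)` at once. -/
theorem exists_partite_ramsey_family {V : Type w} {I : Type} [Finite V] [Finite I]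
    (R : SimpleGraph V) (π : V → I) {J : Type*} (A : J → Type w) [∀ j, Finite (A j)]
    (S : ∀ j, SimpleGraph (A j)) (e : ∀ j, A j → I) (he : ∀ j, (e j).Injective) (D : Finset J) :
    ∃ (W : Type w) (_ : Finite W) (R' : SimpleGraph W) (π' : W → I),
      ∀ χ : ∀ j, (A j → W) → Prop, ∃ β, IsLevelHom R π R' π' β ∧
        ∀ j ∈ D, ∃ c, ∀ α, IsLevelHom (S j) (e j) R π α → χ j (β ∘ α) = c := by
  classical
  induction D using Finset.induction_on with
  | empty =>
    exact ⟨V, inferInstance, R, π, fun χ => ⟨id, ⟨fun _ _ => Iff.rfl, fun _ => rfl⟩, by simp⟩⟩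
  | insert j D _ ih =>
    obtain ⟨W, _, R', π', h⟩ := ih
    -- The new pattern is made monochromatic on a copy of all of `W`, inside which the earlier
    -- patterns are then treated.
    obtain ⟨X, hX, R'', π'', h'⟩ := exists_partite_ramsey R' π' (S j) (e j) (he j)
    refine ⟨X, hX, R'', π'', fun χ => ?_⟩
    obtain ⟨γ, hγ, c, hc⟩ := h' (χ j)
    obtain ⟨β, hβ, hD⟩ := h fun j α => χ j (γ ∘ α)
    refine ⟨γ ∘ β, hγ.comp hβ, fun j' hj' => ?_⟩
    rcases Finset.mem_insert.1 hj' with rfl | hj'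
    · exact ⟨c, fun α hα => hc (β ∘ α) (hβ.comp hα)⟩
    · exact hD j' hj'

/-! ### From Ramsey's theorem to ordered graphs -/

/-- Ramsey's theorem for strictly monotone tuples: finitely many colourings of the tuples of a
large finite linear order are homogeneous on a copy of `B`. -/
theorem exists_ramsey_strictMono {B : Type*} [LinearOrder B] [Finite B] {J : Type*} [Finite J]
    (A : J → Type*) [∀ j, LinearOrder (A j)] [∀ j, Finite (A j)] :
    ∃ n : ℕ, ∀ c : ∀ j, (A j → Fin n) → Prop, ∃ h : B → Fin n, StrictMono h ∧
      ∀ j, ∀ f g : A j → B, StrictMono f → StrictMono g → (c j (h ∘ f) ↔ c j (h ∘ g)) := by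
  classical
  have := fun j => Fintype.ofFinite (A j)
  have := Fintype.ofFinite B
  have := Fintype.ofFinite J
  by_contra! hbad
  choose c hc using hbad
  -- A finite set gets the bad colour of its unique increasing enumeration; the `+ 1` is there
  -- because homogeneity covers sizes strictly below the bound.
  obtain ⟨n, F, hF, hn, hhom⟩ := exists_homogeneous_finset
    (fun n j s => ∃ e : A j → Fin n, StrictMono e ∧
      Finset.univ.image (fun a => (e a : ℕ)) = s ∧ c n j e)
    (Finset.univ.sup (fun j => Fintype.card (A j)) + 1) (Fintype.card B)
  let o := (Fintype.orderIsoFinOfCardEq B rfl).symm.trans (F.orderIsoOfFin hF)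
  let h : B → Fin n := fun b => ⟨o b, hn _ (o b).2⟩
  have hmono : StrictMono h := fun a b hab => o.strictMono hab
  obtain ⟨j, f, g, hf, hg, hne⟩ := hc n h hmono
  have color : ∀ f : A j → B, StrictMono f →
      (c n j (h ∘ f) ↔ ∃ e : A j → Fin n, StrictMono e ∧
        Finset.univ.image (fun a => (e a : ℕ)) = Finset.univ.image (fun a => (o (f a) : ℕ)) ∧
        c n j e) := by
    intro f hf
    refine ⟨fun H => ⟨h ∘ f, hmono.comp hf, rfl, H⟩, ?_⟩
    rintro ⟨e, he, himg, H⟩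
    have : e = h ∘ f := by
      rw [← he.range_inj (hmono.comp hf)]
      apply (Set.image_injective.2 Fin.val_injective)
      rw [← Set.range_comp, ← Set.range_comp]
      have := congrArg (fun s : Finset ℕ => (s : Set ℕ)) himg
      simp only [Finset.coe_image, Finset.coe_univ, Set.image_univ] at this
      exact this
    rwa [← this]
  have hsub : ∀ f : A j → B, Finset.univ.image (fun a => (o (f a) : ℕ)) ⊆ F := by
    intro f x hx
    obtain ⟨a, _, rfl⟩ := Finset.mem_image.1 hx
    exact (o (f a)).2
  have hcard : ∀ f : A j → B, StrictMono f →
      (Finset.univ.image (fun a => (o (f a) : ℕ))).card = Fintype.card (A j) := by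
    intro f hf
    exact Finset.card_image_of_injective _
      (Subtype.val_injective.comp (o.injective.comp hf.injective))
  have := hhom j _ (hsub f) _ (hsub g) (by rw [hcard f hf, hcard g hg]) (by
    rw [hcard f hf]
    exact Nat.lt_succ_of_le (Finset.le_sup (f := fun j => Fintype.card (A j)) (Finset.mem_univ j)))
  rw [← color f hf, ← color g hg] at this
  tauto

/-- The Nešetřil–Rödl theorem for ordered graphs, in the form: for a finite ordered graph `B` and
finitely many finite ordered graphs `A j` there is a finite graph such that for all colourings
of tuples there is a copy of `B` in which the copies of each `A j` have the same colour. -/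
theorem exists_ramsey_orderedGraph {B : Type w} [LinearOrder B] [Finite B] (R : SimpleGraph B)
    {J : Type*} [Finite J] (A : J → Type w) [∀ j, LinearOrder (A j)] [∀ j, Finite (A j)]
    (S : ∀ j, SimpleGraph (A j)) :
    ∃ (W : Type w) (R' : SimpleGraph W), ∀ χ : ∀ j, (A j → W) → Prop,
      ∃ β : B → W, (∀ x y, R'.Adj (β x) (β y) ↔ R.Adj x y) ∧
        ∀ j, ∀ f g : A j → B, StrictMono f → StrictMono g →
          (∀ x y, R.Adj (f x) (f y) ↔ (S j).Adj x y) →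
          (∀ x y, R.Adj (g x) (g y) ↔ (S j).Adj x y) → (χ j (β ∘ f) ↔ χ j (β ∘ g)) := by
  classical
  obtain ⟨n, hn⟩ := exists_ramsey_strictMono (B := B) A
  let P := Σ j, {e : A j → Fin n // StrictMono e}
  have := Fintype.ofFinite P
  -- For every placement `h` of `B` on the levels, the vertices `(h, x)` form a copy of `B` placed
  -- by `h`.
  obtain ⟨W, _, R', π', hW⟩ := exists_partite_ramsey_family
    (R.comap (Prod.snd : (B → Fin n) × B → B)) (fun p => p.1 p.2) (fun p : P => A p.1)
    (fun p => S p.1) (fun p => p.2.1) (fun p => p.2.2.injective) Finset.univ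
  refine ⟨W, R', fun χ => ?_⟩
  obtain ⟨β, hβ, hc⟩ := hW fun p => χ p.1
  choose c hc using fun p => hc p (Finset.mem_univ p)
  obtain ⟨h, hh, hhom⟩ := hn fun j e => ∃ he : StrictMono e, c ⟨j, e, he⟩
  refine ⟨fun x => β (h, x), fun x y => hβ.adj_iff _ _, fun j => ?_⟩
  have color : ∀ f : A j → B, StrictMono f → (∀ x y, R.Adj (f x) (f y) ↔ (S j).Adj x y) →
      (χ j ((fun x => β (h, x)) ∘ f) ↔ ∃ he : StrictMono (h ∘ f), c ⟨j, h ∘ f, he⟩) := by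
    intro f hf hadj
    have := hc ⟨j, h ∘ f, hh.comp hf⟩ (fun a => (h, f a)) ⟨hadj, fun _ => rfl⟩
    exact (iff_of_eq this).trans ⟨fun H => ⟨hh.comp hf, H⟩, fun ⟨_, H⟩ => H⟩
  intro f g hf hg hf' hg'
  rw [color f hf hf', color g hg hg']
  exact hhom j f g hf hg

/-! ### Indiscernibles and the ultraproduct -/

/-- A finite part of an ordered graph is coded by tuples on which finitely many formulas do not
distinguish isomorphic ordered subgraphs. -/
theorem exists_finite_indiscernible {T : L.Theory} {k : ℕ} {φ : L.Formula (Fin k ⊕ Fin k)}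
    (hφ : CodesGraphs.{u, v, w} T φ) {G : Type w} [LinearOrder G] (R : SimpleGraph G)
    (D : Finset (Σ H : Finset G, L.Formula (H × Fin k))) (B : Finset G) :
    ∃ (M : FirstOrder.Language.Theory.ModelType.{u, v, max u v w} T) (a : G → Fin k → M),
      (∀ g ∈ B, ∀ h ∈ B, φ.Realize (Sum.elim (a g) (a h)) ↔ R.Adj g h) ∧
      ∀ p ∈ D, p.1 ⊆ B → ∀ f : p.1 → G, StrictMono f → (∀ g, f g ∈ B) →
        (∀ g h, R.Adj (f g) (f h) ↔ R.Adj g h) →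
        (p.2.Realize (fun q => a q.1 q.2) ↔ p.2.Realize (fun q => a (f q.1) q.2)) := by
  classical
  obtain ⟨W, R', hW⟩ := exists_ramsey_orderedGraph (R.induce (B : Set G)) (J := D)
    (fun p => p.1.1) (fun p => R.induce (p.1.1 : Set G))
  obtain ⟨M, c, hc⟩ := hφ W R'
  obtain ⟨β, hβ, hhom⟩ := hW fun p t => p.1.2.Realize fun q => c (t q.1) q.2
  have a₀ : Fin k → M := fun _ => Classical.arbitrary M
  refine ⟨M, fun g => if h : g ∈ B then c (β ⟨g, h⟩) else a₀, ?_, ?_⟩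
  · intro g hg h hh
    simp only [dif_pos hg, dif_pos hh, hc, hβ]
    rfl
  · intro p hp hpB f hf hfB hadj
    have := hhom ⟨p, hp⟩ (fun g => ⟨g, hpB g.2⟩) (fun g => ⟨f g, hfB g⟩)
      (fun _ _ h => h) (fun _ _ h => hf h) (fun _ _ => Iff.rfl) hadj
    have h1 : ∀ q : p.1, (q : G) ∈ B := fun q => hpB q.2
    simpa only [h1, hfB, dif_pos, Function.comp_apply] using this

open Filter in
/-- Every ordered graph is coded by a graph-indiscernible family of tuples. -/
theorem exists_graphIndiscernible {T : L.Theory} {k : ℕ} {φ : L.Formula (Fin k ⊕ Fin k)}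
    (hφ : CodesGraphs.{u, v, w} T φ) {G : Type w} [LinearOrder G] (R : SimpleGraph G) :
    ∃ (M : FirstOrder.Language.Theory.ModelType.{u, v, max u v w} T) (a : G → Fin k → M),
      GraphIndiscernible L R a ∧
      ∀ g h : G, φ.Realize (Sum.elim (a g) (a h)) ↔ R.Adj g h := by
  classical
  choose M a hadj hind using fun i : Finset (Σ H : Finset G, L.Formula (H × Fin k)) × Finset G =>
    exists_finite_indiscernible hφ R i.1 i.2
  let I := Finset (Σ H : Finset G, L.Formula (H × Fin k)) × Finset G
  -- Each instance of indiscernibility or coding involves finitely many data, so it holds from some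
  -- index on.
  let U : Ultrafilter I := Ultrafilter.of atTop
  have hU : ∀ i : I, ∀ᶠ j in (U : Filter I), i ≤ j := fun i =>
    Ultrafilter.of_le atTop (eventually_ge_atTop i)
  let N := (U : Filter I).Product fun i => (M i : Type max u v w)
  have : N ⊨ T := ⟨fun σ hσ => (FirstOrder.Language.Ultraproduct.sentence_realize σ).2
    (Eventually.of_forall fun i => (M i).is_model.realize_of_mem σ hσ)⟩
  let a' : G → Fin k → N := fun g x => ((fun i => a i g x : ∀ i, M i) : N)
  refine ⟨FirstOrder.Language.Theory.ModelType.of T N, a', ?_, ?_⟩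
  · intro H₁ H₂ f hf ψ
    refine (FirstOrder.Language.Ultraproduct.realize_formula_cast ψ
      (fun q i => a i q.1 q.2)).trans (Iff.trans ?_
      (FirstOrder.Language.Ultraproduct.realize_formula_cast ψ
      (fun q i => a i (f q.1) q.2)).symm)
    apply eventually_congr
    filter_upwards [hU ({⟨H₁, ψ⟩}, H₁ ∪ H₂)] with i hi
    have hB := Finset.union_subset_iff.1 hi.2
    exact hind i ⟨H₁, ψ⟩ (hi.1 (Finset.mem_singleton_self _)) hB.1 (fun g => f g)
      (fun _ _ h => f.strictMono h) (fun g => hB.2 (f g).2) hf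
  · intro g h
    have e : (Sum.elim (a' g) (a' h)) =
        fun x => ((Sum.elim (fun y i => a i g y) (fun y i => a i h y) x : ∀ i, M i) : N) := by
      funext x; cases x <;> rfl
    refine (iff_of_eq (congrArg φ.Realize e)).trans
      ((FirstOrder.Language.Ultraproduct.realize_formula_cast φ _).trans ?_)
    have : ∀ᶠ i in (U : Filter I), (φ.Realize (fun x =>
        Sum.elim (fun y i => a i g y) (fun y i => a i h y) x i) ↔ R.Adj g h) := by
      filter_upwards [hU (∅, {g, h})] with i hi
      rw [← hadj i g (hi.2 (by simp)) h (hi.2 (by simp))]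
      refine iff_of_eq (congrArg φ.Realize ?_)
      funext x; cases x <;> rfl
    rw [eventually_congr this, eventually_const]

/-! ### Definable closure and the generated submodel -/

/-- An element that is the value of a term at elements of `A` lies in the definable closure
of `A`. -/
theorem mem_dcl_of_term {M : Type w} [L.Structure M] {A : Set M} (t : L.Term A) :
    t.realize ((↑) : A → M) ∈ dcl L A := by
  refine Set.definable_iff_exists_formula_sum.2
    ⟨(FirstOrder.Language.Term.var (Sum.inr 0)).equal (t.relabel Sum.inl), ?_⟩
  ext x
  simp [FirstOrder.Language.Formula.realize_equal, Function.comp_def]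

/-- In the substructure generated by `A`, everything is in the definable closure of `A`. -/
theorem dcl_closure_eq_univ {M : Type w} [L.Structure M] (A : Set M) :
    dcl L {x : FirstOrder.Language.Substructure.closure L A | (x : M) ∈ A} = Set.univ := by
  refine Set.eq_univ_of_forall fun x => ?_
  obtain ⟨t, ht⟩ := FirstOrder.Language.Substructure.mem_closure_iff_exists_term.1 x.2
  let S := FirstOrder.Language.Substructure.closure L A
  let t' : L.Term {x : S | (x : M) ∈ A} := t.relabel fun y : A =>
    ⟨⟨y.1, FirstOrder.Language.Substructure.subset_closure y.2⟩, y.2⟩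
  have : t'.realize ((↑) : {x : S | (x : M) ∈ A} → S) = x := by
    apply Subtype.ext
    rw [← ht]
    have := FirstOrder.Language.HomClass.realize_term S.subtype (t := t')
      (v := ((↑) : {x : S | (x : M) ∈ A} → S))
    refine this.symm.trans ?_
    rw [FirstOrder.Language.Term.realize_relabel]
    rfl
  rw [← this]
  exact mem_dcl_of_term t'

/-- A formula without free variables does not code graphs. -/
theorem CodesGraphs.ne_zero {T : L.Theory} {k : ℕ} {φ : L.Formula (Fin k ⊕ Fin k)}
    (hφ : CodesGraphs.{u, v, w} T φ) : k ≠ 0 := by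
  rintro rfl
  obtain ⟨M, c, hc⟩ := hφ (ULift Bool) ⊤
  have h1 := (hc ⟨true⟩ ⟨false⟩).2 (by simp)
  have h2 := (hc ⟨true⟩ ⟨true⟩).1 (by rwa [Subsingleton.elim (c ⟨true⟩) (c ⟨false⟩)] at h1 ⊢)
  exact h2.ne rfl

end GraphEM

theorem theorem2p3 {L : FirstOrder.Language.{u, v}} (T : L.Theory)
    (hT : GraphEM.IsSkolemized.{u, v, max u v w} T)
    {k : ℕ} (φ : L.Formula (Fin k ⊕ Fin k)) (hφ : GraphEM.CodesGraphs.{u, v, w} T φ)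
    (G : Type w) [LinearOrder G] (R : SimpleGraph G) (hG : Nonempty G ∨ Nonempty L.Constants) :
    ∃ (M : FirstOrder.Language.Theory.ModelType.{u, v, max u v w} T) (a : G → Fin k → M),
      GraphEM.dcl L {x : M | ∃ (g : G) (i : Fin k), a g i = x} = Set.univ ∧
      GraphEM.GraphIndiscernible L R a ∧
      ∀ g h : G, φ.Realize (Sum.elim (a g) (a h)) ↔ R.Adj g h := by
  obtain ⟨M, a, hind, hadj⟩ := GraphEM.exists_graphIndiscernible hφ R
  let A : Set M := {x | ∃ (g : G) (i : Fin k), a g i = x}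
  let S := FirstOrder.Language.Substructure.closure L A
  have hA : ∀ g i, a g i ∈ S := fun g i =>
    FirstOrder.Language.Substructure.subset_closure ⟨g, i, rfl⟩
  have hne : (S : Set M).Nonempty := by
    rcases hG with ⟨⟨g⟩⟩ | ⟨⟨c⟩⟩
    · exact ⟨_, hA g ⟨0, Nat.pos_of_ne_zero hφ.ne_zero⟩⟩
    · exact ⟨_, S.constants_mem c⟩
  let E : L.ElementarySubstructure M := ⟨S, hT M S hne⟩
  have : Nonempty E := hne.to_subtype
  have : E ⊨ T := (E.theory_model_iff T).2 inferInstance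
  let a' : G → Fin k → E := fun g i => ⟨a g i, hA g i⟩
  refine ⟨FirstOrder.Language.Theory.ModelType.of T E, a', ?_, ?_, ?_⟩
  · refine Eq.trans ?_ (GraphEM.dcl_closure_eq_univ A)
    congr 1
    ext x
    exact ⟨fun ⟨g, i, h⟩ => ⟨g, i, congrArg Subtype.val h⟩, fun ⟨g, i, h⟩ => ⟨g, i, Subtype.ext h⟩⟩
  · intro H₁ H₂ f hf ψ
    exact (E.subtype.map_formula ψ _).symm.trans
      ((hind H₁ H₂ f hf ψ).trans (E.subtype.map_formula ψ fun q => a' (f q.1) q.2))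
  · intro g h
    rw [← hadj g h]
    refine (E.subtype.map_formula φ _).symm.trans (iff_of_eq (congrArg φ.Realize ?_))
    funext x; cases x <;> rfl
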